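/- Let $f:S^2\to S^2$ be an orientation-preserving homeomorphism of the two-dimensional sphere. If $f$ has a periodic point of (least) period $2$, i.e. a point $p\in S^2$ with $f(p)\neq p$ and $f(f(p))=p$, then $f$ has at least two fixed points: there are $x\neq y$ in $S^2$ with $f(x)=x$ and $f(y)=y$. -/

import Mathlib

open Filter Topology

/-- Euclidean three-space. -/
abbrev E3 : Type := EuclideanSpace ℝ (Fin 3)

/-- The sphere `S²`: the unit sphere of Euclidean three-space. -/
abbrev S2 : Type := Metric.sphere (0 : E3) 1

/-- The loop `c : [0,1] → ℂ ∖ {0}` has winding number `n` around the origin: it has a continuous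
logarithm on `[0,1]`, which increases by `2πi n` from `0` to `1`.
(The condition forces `c` to be continuous and non-zero on `[0,1]`, with `c 0 = c 1`.) -/
def HasWindingNumber (c : ℝ → ℂ) (n : ℤ) : Prop :=
  ∃ L : ℝ → ℂ, ContinuousOn L (Set.Icc 0 1) ∧
    (∀ t ∈ Set.Icc (0 : ℝ) 1, Complex.exp (L t) = c t) ∧
    L 1 - L 0 = 2 * Real.pi * Complex.I * n

/-- `b` is a right-handed orthonormal frame of three-space whose last vector is `x`; then `b 0, b 1`
is an oriented orthonormal basis of the tangent plane of `S²` at `x`, for the orientation of `S²`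
by its outward normal. -/
def IsOrientedFrameAt (b : OrthonormalBasis (Fin 3) ℝ E3) (x : S2) : Prop :=
  b 2 = (x : E3) ∧
    b.toBasis.orientation = (EuclideanSpace.basisFun (Fin 3) ℝ).toBasis.orientation

/-- The circle of angular radius `r` on `S²` with centre `b 2`, run through once for `t ∈ [0,1]`,
in the direction from `b 0` to `b 1`. -/
noncomputable def frameCircle (b : OrthonormalBasis (Fin 3) ℝ E3) (r t : ℝ) : S2 :=
  ⟨b.repr.symm (WithLp.toLp 2 ![Real.sin r * Real.cos (2 * Real.pi * t),
      Real.sin r * Real.sin (2 * Real.pi * t), Real.cos r]), by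
    rw [mem_sphere_zero_iff_norm, LinearIsometryEquiv.norm_map, EuclideanSpace.norm_eq,
      Real.sqrt_eq_one]
    simp only [Fin.sum_univ_three, Real.norm_eq_abs, sq_abs, Matrix.cons_val_zero,
      Matrix.cons_val_one, Matrix.cons_val]
    have h1 := Real.sin_sq_add_cos_sq r
    have h2 := Real.sin_sq_add_cos_sq (2 * Real.pi * t)
    linear_combination h1 + Real.sin r ^ 2 * h2⟩

/-- The complex coordinate on `S²` given by the orthogonal projection to the plane of `b 0, b 1`.
For an oriented frame at `x` it is an oriented chart of the open hemisphere around `x`, with `x`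
at the origin. -/
noncomputable def frameCoord (b : OrthonormalBasis (Fin 3) ℝ E3) (y : S2) : ℂ :=
  ⟨b.repr (y : E3) 0, b.repr (y : E3) 1⟩

/-- A homeomorphism of `S²` preserves orientation if it has local degree `1` at every point `x`:
in oriented coordinates, it maps every sufficiently small positive circle around `x` to a
loop with winding number `1` around `f x`. -/
def IsOrientationPreserving (f : S2 ≃ₜ S2) : Prop :=
  ∀ (x : S2) (b b' : OrthonormalBasis (Fin 3) ℝ E3),
    IsOrientedFrameAt b x → IsOrientedFrameAt b' (f x) →
      ∀ᶠ r : ℝ in 𝓝[>] 0, HasWindingNumber (fun t => frameCoord b' (f (frameCircle b r t))) 1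

/-! Let `p` and `q` be the two points of the orbit. The first fixed point comes from a degree count.
In the stereographic chart that sends `p` to `∞` and `q` to `a`, the map becomes a self-map `h` of
`ℂ ∖ {a}` that interchanges the two ends and satisfies `h - a` of winding number `-1`. If `h` had no
fixed point, `z - h z` would have the same winding number on all circles around `a`. On large
circles `h` is close to `a`, so it is `1`; on small ones `h` dominates, so it is `-1`
(`exists_fixedPoint_of_interchange_ends`).

For the second, send a fixed point `x` to `∞`. Now `h` is an injection of the plane of degree `1` at
infinity that swaps two points. Let `Λ` be a continuous logarithm of the factor by which `h`
multiplies the vector between two distinct points. Degree `1` makes `Λ` depend only on the unordered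
pair. Without fixed points, `h z - z` has a continuous logarithm `F`, and `F (h z) - F z` is `Λ` of
the pair `z, h z`, up to a constant `2πik`. Adding these relations at the two swapped points gives
`Λ = -2πik` there, so the factor is `1`; but a swap has factor `-1`
(`exists_fixedPoint_of_interchange`). -/

/-! ### Continuous logarithms. -/

theorem exists_continuous_log {A : Type*} [TopologicalSpace A] [SimplyConnectedSpace A]
    [LocallyPathConnectedSpace A] {g : A → ℂ} (hg : Continuous g) (h0 : ∀ a, g a ≠ 0) :
    ∃ L : A → ℂ, Continuous L ∧ ∀ a, Complex.exp (L a) = g a := by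
  obtain ⟨a₀⟩ : Nonempty A := inferInstance
  obtain ⟨F, ⟨-, hF⟩, -⟩ := Complex.isCoveringMapOn_exp.existsUnique_continuousMap_lifts
    ⟨g, hg⟩ (a₀ := a₀) (e₀ := Complex.log (g a₀)) (by simp [Complex.exp_log (h0 a₀)])
    (fun a => by simpa using h0 a)
  exact ⟨F, F.continuous, fun a => congrFun hF a⟩

/-- Uniqueness of lifts through the covering `exp`: a translate of `L'` that agrees with `L` at one
point agrees on all of `S`. -/
theorem IsPreconnected.exists_int_of_exp_eq {A : Type*} [TopologicalSpace A] {S : Set A}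
    (hS : IsPreconnected S) {L L' : A → ℂ} (hL : ContinuousOn L S) (hL' : ContinuousOn L' S)
    (h : ∀ a ∈ S, Complex.exp (L a) = Complex.exp (L' a)) :
    ∃ n : ℤ, ∀ a ∈ S, L a = L' a + n * (2 * Real.pi * Complex.I) := by
  rcases S.eq_empty_or_nonempty with rfl | ⟨a₀, ha₀⟩
  · exact ⟨0, by simp⟩
  obtain ⟨n, hn⟩ := Complex.exp_eq_exp_iff_exists_int.1 (h a₀ ha₀)
  refine ⟨n, fun a ha => ?_⟩
  refine Complex.isCoveringMap_exp.eqOn_of_comp_eqOn hS hL (hL'.add continuousOn_const)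
    (fun b hb => Subtype.ext ?_) ha₀ hn ha
  exact (h b hb).trans (Complex.exp_eq_exp_iff_exists_int.2 ⟨-n, by simp⟩)

theorem exists_int_shift {A : Type*} [TopologicalSpace A] [PreconnectedSpace A] {L : A → ℂ}
    (hL : Continuous L) {T : A → A} (hT : Continuous T)
    (h : ∀ a, Complex.exp (L (T a)) = Complex.exp (L a)) :
    ∃ n : ℤ, ∀ a, L (T a) = L a + n * (2 * Real.pi * Complex.I) := by
  obtain ⟨n, hn⟩ := isPreconnected_univ.exists_int_of_exp_eq (hL.comp hT).continuousOn
    hL.continuousOn (fun a _ => h a)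
  exact ⟨n, fun a => hn a trivial⟩

theorem eq_of_mul_two_pi_I_eq {m n : ℤ}
    (h : (m : ℂ) * (2 * Real.pi * Complex.I) = n * (2 * Real.pi * Complex.I)) : m = n := by
  exact_mod_cast mul_right_cancel₀ Complex.two_pi_I_ne_zero h

/-! ### Winding numbers of loops. -/

namespace HasWindingNumber

theorem congr {c d : ℝ → ℂ} {n : ℤ} (hc : HasWindingNumber c n)
    (h : ∀ t ∈ Set.Icc (0 : ℝ) 1, d t = c t) : HasWindingNumber d n := by
  obtain ⟨L, hL, he, hn⟩ := hc
  exact ⟨L, hL, fun t ht => (he t ht).trans (h t ht).symm, hn⟩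

theorem unique {c : ℝ → ℂ} {m n : ℤ} (hm : HasWindingNumber c m) (hn : HasWindingNumber c n) :
    m = n := by
  obtain ⟨L, hL, he, h⟩ := hm
  obtain ⟨L', hL', he', h'⟩ := hn
  obtain ⟨k, hk⟩ := isPreconnected_Icc.exists_int_of_exp_eq hL hL'
    (fun t ht => (he t ht).trans (he' t ht).symm)
  have h0 := hk 0 (by simp)
  have h1 := hk 1 (by simp)
  exact eq_of_mul_two_pi_I_eq (by linear_combination h' - h + h1 - h0)

theorem conj {c : ℝ → ℂ} {n : ℤ} (hc : HasWindingNumber c n) :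
    HasWindingNumber (fun t => (starRingEnd ℂ) (c t)) (-n) := by
  obtain ⟨L, hL, he, hn⟩ := hc
  refine ⟨fun t => (starRingEnd ℂ) (L t), Complex.continuous_conj.comp_continuousOn hL,
    fun t ht => by rw [Complex.exp_conj, he t ht], ?_⟩
  rw [← map_sub, hn]
  simp [Complex.conj_ofNat]

/-- The principal logarithm is continuous on the slit plane, so the closed factor `e` adds no
winding. -/
theorem mul_slitPlane {c e : ℝ → ℂ} {n : ℤ} (hc : HasWindingNumber c n)
    (he : ContinuousOn e (Set.Icc 0 1)) (hs : ∀ t ∈ Set.Icc (0 : ℝ) 1, e t ∈ Complex.slitPlane)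
    (h01 : e 0 = e 1) : HasWindingNumber (fun t => c t * e t) n := by
  obtain ⟨L, hL, hexp, hn⟩ := hc
  refine ⟨fun t => L t + Complex.log (e t), hL.add (he.clog hs), fun t ht => ?_, ?_⟩
  · rw [Complex.exp_add, hexp t ht, Complex.exp_log (Complex.slitPlane_ne_zero (hs t ht))]
  · simp only [h01]; linear_combination hn

theorem ne_zero {c : ℝ → ℂ} {n : ℤ} (hc : HasWindingNumber c n) {t : ℝ}
    (ht : t ∈ Set.Icc (0 : ℝ) 1) : c t ≠ 0 := by
  obtain ⟨L, -, he, -⟩ := hc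
  exact he t ht ▸ Complex.exp_ne_zero _

theorem continuousOn {c : ℝ → ℂ} {n : ℤ} (hc : HasWindingNumber c n) :
    ContinuousOn c (Set.Icc 0 1) := by
  obtain ⟨L, hL, he, -⟩ := hc
  exact (Complex.continuous_exp.comp_continuousOn hL).congr (fun t ht => (he t ht).symm)

theorem closed {c : ℝ → ℂ} {n : ℤ} (hc : HasWindingNumber c n) : c 0 = c 1 := by
  obtain ⟨L, -, he, hn⟩ := hc
  rw [← he 0 (by simp), ← he 1 (by simp)]
  exact Complex.exp_eq_exp_iff_exists_int.2 ⟨-n, by push_cast; linear_combination -hn⟩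

/-- Rouché's principle: `c - d = c * (1 - d / c)`, and the second factor stays in the disc of radius
`1` about `1`. -/
theorem of_norm_lt {c d : ℝ → ℂ} {n : ℤ} (hc : HasWindingNumber c n)
    (hd : ContinuousOn d (Set.Icc 0 1)) (h01 : d 0 = d 1)
    (h : ∀ t ∈ Set.Icc (0 : ℝ) 1, ‖d t‖ < ‖c t‖) : HasWindingNumber (fun t => c t - d t) n := by
  refine (hc.mul_slitPlane (e := fun t => 1 - d t / c t)
    (continuousOn_const.sub (hd.div hc.continuousOn fun t ht => hc.ne_zero ht)) ?_ ?_).congr ?_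
  · intro t ht
    refine Complex.mem_slitPlane_of_norm_lt_one (z := -(d t / c t)) ?_ |> fun h => by
      simpa [sub_eq_add_neg] using h
    rw [norm_neg, norm_div, div_lt_one (norm_pos_iff.2 (hc.ne_zero ht))]
    exact h t ht
  · simp only [h01, hc.closed]
  · intro t ht
    have := hc.ne_zero ht
    field_simp

end HasWindingNumber

/-- The circle of radius `R` around the origin, run through once for `t ∈ [0,1]`. -/
noncomputable def planeCircle (R t : ℝ) : ℂ :=
  Complex.exp (Real.log R + 2 * Real.pi * Complex.I * t)

theorem continuous_planeCircle (R : ℝ) : Continuous (planeCircle R) := by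
  unfold planeCircle; fun_prop

theorem planeCircle_zero_eq_one (R : ℝ) : planeCircle R 0 = planeCircle R 1 := by
  refine Complex.exp_eq_exp_iff_exists_int.2 ⟨-1, ?_⟩
  push_cast; ring

theorem norm_planeCircle {R : ℝ} (hR : 0 < R) (t : ℝ) : ‖planeCircle R t‖ = R := by
  rw [planeCircle, Complex.norm_exp]
  simp [Real.exp_log hR]

/-- Circles lift through `exp` to vertical segments of length `2π`, so the winding number is the
shift of `H` under the period, whatever `R` is. -/
theorem hasWindingNumber_exp_comp {H : ℂ → ℂ} (hH : Continuous H) {n : ℤ}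
    (hn : ∀ s, H (s + 2 * Real.pi * Complex.I) = H s + n * (2 * Real.pi * Complex.I)) (R : ℝ) :
    HasWindingNumber (fun t => Complex.exp (H (Real.log R + 2 * Real.pi * Complex.I * t))) n := by
  refine ⟨fun t => H (Real.log R + 2 * Real.pi * Complex.I * t),
    (hH.comp (by fun_prop)).continuousOn, fun t _ => rfl, ?_⟩
  simp only [Complex.ofReal_one, Complex.ofReal_zero, mul_one, mul_zero, add_zero, hn]
  ring

theorem hasWindingNumber_planeCircle (R : ℝ) : HasWindingNumber (planeCircle R) 1 :=
  hasWindingNumber_exp_comp (H := id) continuous_id (by simp) R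

/-! ### Fixed points of maps of the plane and of the punctured plane. -/

/-- A plane injection which is positively oriented near infinity and interchanges two points
has a fixed point. -/
theorem exists_fixedPoint_of_interchange {h : ℂ → ℂ} (hc : Continuous h)
    (hi : Function.Injective h) {R : ℝ}
    (hw : HasWindingNumber (fun t => h (planeCircle R t) - h 0) 1) {p q : ℂ} (hpq : p ≠ q)
    (hp : h p = q) (hq : h q = p) : ∃ z, h z = z := by
  by_contra! hfix
  obtain ⟨F, hFc, hF⟩ := exists_continuous_log (hc.sub continuous_id)
    (fun z => sub_ne_zero.2 (hfix z))
  replace hF : ∀ z, Complex.exp (F z) = h z - z := hF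
  -- `(w, s)` encodes the ordered pair of distinct points `w`, `w + exp s`; injectivity of `h` keeps
  -- the quotient non-zero.
  obtain ⟨Λ, hΛc, hΛ⟩ := exists_continuous_log (A := ℂ × ℂ)
    (g := fun x => (h (x.1 + Complex.exp x.2) - h x.1) / Complex.exp x.2)
    (Continuous.div (by fun_prop) (by fun_prop) fun x => Complex.exp_ne_zero _)
    (fun x => div_ne_zero (sub_ne_zero.2 fun he => Complex.exp_ne_zero x.2
      (by simpa using hi he)) (Complex.exp_ne_zero _))
  -- `T` exchanges the two points of the pair, which leaves the quotient unchanged; `T` twice is the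
  -- shift of `s` by `2πi`.
  obtain ⟨m, hm⟩ := exists_int_shift hΛc
    (T := fun x => (x.1 + Complex.exp x.2, x.2 + Real.pi * Complex.I)) (by fun_prop) (by
      intro x
      rw [hΛ, hΛ]
      simp only [Complex.exp_add, Complex.exp_pi_mul_I]
      have := Complex.exp_ne_zero x.2
      field_simp
      ring_nf)
  have hper : ∀ w s, Λ (w, s + 2 * Real.pi * Complex.I)
      = Λ (w, s) + (2 * m : ℤ) * (2 * Real.pi * Complex.I) := by
    intro w s
    have h1 := hm (w + Complex.exp s, s + Real.pi * Complex.I)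
    have h2 := hm (w, s)
    simp only [Complex.exp_add, Complex.exp_pi_mul_I] at h1 h2
    rw [h2, show w + Complex.exp s + Complex.exp s * -1 = w by ring,
      show s + Real.pi * Complex.I + Real.pi * Complex.I = s + 2 * Real.pi * Complex.I by ring]
      at h1
    rw [h1]; push_cast; ring
  have hm0 : m = 0 := by
    -- `Λ (0, s) + s` is a logarithm of `h (exp s) - h 0`, so the degree at infinity is `2m + 1`.
    have h1 := hasWindingNumber_exp_comp (H := fun s => Λ (0, s) + s) (n := 2 * m + 1)
      (by fun_prop) (fun s => by rw [hper]; push_cast; ring) R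
    have h2 := hw.unique (h1.congr fun t _ => by
      rw [Complex.exp_add, hΛ, div_mul_cancel₀ _ (Complex.exp_ne_zero _), zero_add]; rfl)
    omega
  subst hm0
  obtain ⟨k, hk⟩ := isPreconnected_univ.exists_int_of_exp_eq
    (L := fun z => F (h z) - F z) (L' := fun z => Λ (z, F z))
    (by fun_prop) (by fun_prop) (fun z _ => by
      rw [Complex.exp_sub, hF, hF, hΛ, hF]; simp)
  have hkp := hk p trivial
  have hkq := hk q trivial
  simp only [hp, hq] at hkp hkq
  have hswap := hm (p, F p)
  simp only [hF, hp, Int.cast_zero, zero_mul, add_zero] at hswap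
  obtain ⟨j, hj⟩ : ∃ j : ℤ, F q = F p + Real.pi * Complex.I + j * (2 * Real.pi * Complex.I) := by
    refine Complex.exp_eq_exp_iff_exists_int.1 ?_
    rw [Complex.exp_add, hF, hF, hp, hq, Complex.exp_pi_mul_I]; ring
  have hperj : ∀ (j : ℤ) w s, Λ (w, s + j * (2 * Real.pi * Complex.I)) = Λ (w, s) := by
    intro j w s
    have := (show Function.Periodic (fun s => Λ (w, s)) (2 * Real.pi * Complex.I) from
      fun s => by simpa using hper w s).int_mul j s
    simpa using this
  have hsym : Λ (q, F q) = Λ (p, F p) := by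
    rw [hj, hperj, ← hswap]; ring_nf
  -- In the sum of `hkp` and `hkq` the values of `F` cancel.
  have h1 : Λ (p, F p) = (-k : ℤ) * (2 * Real.pi * Complex.I) := by
    push_cast; linear_combination (-1/2) * (hkp + hkq + hsym)
  have h2 := hΛ (p, F p)
  rw [h1, Complex.exp_int_mul_two_pi_mul_I] at h2
  simp only [hF, hp, add_sub_cancel, hq] at h2
  have hne := sub_ne_zero.2 hpq.symm
  field_simp at h2
  exact hne (by linear_combination h2/2)

/-- A self-map of the plane with one puncture `a`, which interchanges the ends `a` and `∞` and has
degree `-1`, has a fixed point. -/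
theorem exists_fixedPoint_of_interchange_ends {h : ℂ → ℂ} {a : ℂ} (hc : ContinuousOn h {a}ᶜ)
    (hne : ∀ z, z ≠ a → h z ≠ a) (hinf : Tendsto h (Bornology.cobounded ℂ) (𝓝 a))
    (ha : Tendsto h (𝓝[≠] a) (Bornology.cobounded ℂ)) {R : ℝ} (hR : ‖a‖ < R)
    (hw : HasWindingNumber (fun t => h (planeCircle R t) - a) (-1)) :
    ∃ z, z ≠ a ∧ h z = z := by
  by_contra! hfix
  have hexp : ∀ s, a + Complex.exp s ≠ a := fun s => by simp [Complex.exp_ne_zero]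
  have hcexp : Continuous fun s => h (a + Complex.exp s) :=
    hc.comp_continuous (by fun_prop) (fun s => hexp s)
  have hccirc : ∀ r, Continuous fun t => h (a + planeCircle r t) := fun r =>
    hc.comp_continuous (continuous_const.add (continuous_planeCircle r)) (fun s => hexp _)
  have hexpper : ∀ s, Complex.exp (s + 2 * Real.pi * Complex.I) = Complex.exp s := fun s =>
    Complex.exp_periodic s
  obtain ⟨H, hHc, hH⟩ := exists_continuous_log (hcexp.sub (continuous_const (y := a)))
    (fun s => sub_ne_zero.2 (hne _ (hexp s)))
  obtain ⟨K, hKc, hK⟩ := exists_continuous_log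
    (hcexp.sub (continuous_const.add Complex.continuous_exp))
    (fun s => sub_ne_zero.2 (hfix _ (hexp s)))
  replace hH : ∀ s, Complex.exp (H s) = h (a + Complex.exp s) - a := hH
  replace hK : ∀ s, Complex.exp (K s) = h (a + Complex.exp s) - (a + Complex.exp s) := hK
  obtain ⟨n, hn⟩ := exists_int_shift hHc (T := fun s => s + 2 * Real.pi * Complex.I)
    (by fun_prop) (fun s => by rw [hH, hH, hexpper])
  obtain ⟨m, hm⟩ := exists_int_shift hKc (T := fun s => s + 2 * Real.pi * Complex.I)
    (by fun_prop) (fun s => by rw [hK, hK, hexpper])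
  have hKw : ∀ r, HasWindingNumber (fun t => (a + planeCircle r t) - h (a + planeCircle r t)) m :=
    fun r => (hasWindingNumber_exp_comp (H := fun s => K s + Real.pi * Complex.I) (n := m)
      (by fun_prop) (fun s => by rw [hm]; ring) r).congr fun t _ => by
        rw [Complex.exp_add, hK, Complex.exp_pi_mul_I, planeCircle]; ring
  -- On a large circle around `a`, `z - h z` is the radius vector `z - a` minus the small term `h z
  -- - a`.
  have hm1 : m = 1 := by
    have h1 : ∀ᶠ z in Bornology.cobounded ℂ, ‖h z - a‖ < 1 := by
      have := hinf (Metric.ball_mem_nhds a one_pos)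
      filter_upwards [this] with z hz
      simpa [dist_eq_norm] using hz
    obtain ⟨ρ, hρ⟩ : ∃ ρ : ℝ, ∀ z : ℂ, ρ ≤ ‖z‖ → ‖h z - a‖ < 1 := by
      rw [← comap_norm_atTop, eventually_comap] at h1
      obtain ⟨ρ, hρ⟩ := eventually_atTop.1 h1
      exact ⟨ρ, fun z hz => hρ _ hz z rfl⟩
    have hr : 0 < |ρ| + ‖a‖ + 1 := by positivity
    refine (hKw (|ρ| + ‖a‖ + 1)).unique (((hasWindingNumber_planeCircle (|ρ| + ‖a‖ + 1)).of_norm_lt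
      (d := fun t => h (a + planeCircle (|ρ| + ‖a‖ + 1) t) - a)
      ((hccirc _).sub continuous_const).continuousOn ?_ ?_).congr ?_)
    · simp only [planeCircle_zero_eq_one]
    · intro t _
      rw [norm_planeCircle hr]
      have h2 : ρ ≤ ‖a + planeCircle (|ρ| + ‖a‖ + 1) t‖ := by
        have := norm_sub_norm_le (planeCircle (|ρ| + ‖a‖ + 1) t) (-a)
        rw [norm_planeCircle hr, norm_neg, sub_neg_eq_add, add_comm (planeCircle _ _)] at this
        linarith [le_abs_self ρ]
      linarith [hρ _ h2, abs_nonneg ρ, norm_nonneg a]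
    · intro t _; ring
  -- On a small circle around `a`, `z - h z` is the dominant term `-(h z - a)` plus the small `z -
  -- a`.
  have hmn : m = n := by
    have h1 : ∀ᶠ z in 𝓝[≠] a, 1 < ‖h z - a‖ := by
      have h2 : Tendsto (fun z => ‖h z - a‖) (𝓝[≠] a) atTop := by
        refine tendsto_atTop_mono (fun z => norm_sub_norm_le (h z) a) ?_
        exact tendsto_atTop_add_const_right _ (-‖a‖) (tendsto_norm_cobounded_atTop.comp ha)
      exact h2.eventually_gt_atTop 1
    rw [eventually_nhdsWithin_iff, Metric.eventually_nhds_iff] at h1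
    obtain ⟨ε, hε, h1⟩ := h1
    set r := min (ε / 2) 1 with hrdef
    have hr : 0 < r := by positivity
    refine (hKw r).unique ((hasWindingNumber_exp_comp (H := fun s => H s + Real.pi * Complex.I)
      (n := n) (by fun_prop) (fun s => by rw [hn]; ring) r).of_norm_lt
      (d := fun t => -planeCircle r t) (continuous_planeCircle r).neg.continuousOn ?_ ?_
      |>.congr ?_)
    · simp only [planeCircle_zero_eq_one]
    · intro t _
      have h3 := h1 (y := a + planeCircle r t) (by
        rw [dist_eq_norm, add_sub_cancel_left, norm_planeCircle hr]
        linarith [min_le_left (ε / 2) 1]) (hexp _)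
      rw [Complex.exp_add, hH, Complex.exp_pi_mul_I, norm_neg, norm_planeCircle hr, mul_neg_one,
        norm_neg]
      exact (min_le_right _ _).trans_lt h3
    · intro t _
      rw [Complex.exp_add, hH, Complex.exp_pi_mul_I, planeCircle]; ring
  have hn1 : n = -1 := by
    have hRpos : 0 < R := (norm_nonneg a).trans_lt hR
    -- The circle in `hw` is centred at `0`, not `a`; since `‖a‖ < R` it winds once around `a`, so
    -- its lift `L` also advances by one period.
    obtain ⟨L, hL, hLexp, hL01⟩ := (hasWindingNumber_planeCircle R).of_norm_lt
      (d := fun _ => a) continuousOn_const rfl (fun t _ => by rwa [norm_planeCircle hRpos])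
    refine HasWindingNumber.unique ⟨fun t => H (L t), hHc.comp_continuousOn hL, fun t ht => ?_, ?_⟩
      hw
    · simp only [hH, hLexp t ht, add_sub_cancel]
    · simp only [show L 1 = L 0 + 2 * Real.pi * Complex.I by
        push_cast at hL01; linear_combination hL01, hn]
      ring
  omega

/-! ### Stereographic projection. -/

/-- Stereographic projection from the last vector of an orthonormal frame. -/
noncomputable def stereoProj (b : OrthonormalBasis (Fin 3) ℝ E3) (y : S2) : ℂ :=
  frameCoord b y / ((1 - b.repr (y : E3) 2 : ℝ) : ℂ)

/-- The inverse of stereographic projection from the last vector of an orthonormal frame. -/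
noncomputable def stereoInv (b : OrthonormalBasis (Fin 3) ℝ E3) (z : ℂ) : S2 :=
  ⟨b.repr.symm (WithLp.toLp 2 ![2 * z.re / (z.re ^ 2 + z.im ^ 2 + 1),
      2 * z.im / (z.re ^ 2 + z.im ^ 2 + 1),
      (z.re ^ 2 + z.im ^ 2 - 1) / (z.re ^ 2 + z.im ^ 2 + 1)]), by
    rw [mem_sphere_zero_iff_norm, LinearIsometryEquiv.norm_map, EuclideanSpace.norm_eq,
      Real.sqrt_eq_one]
    simp only [Fin.sum_univ_three, Real.norm_eq_abs, sq_abs, Matrix.cons_val_zero,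
      Matrix.cons_val_one, Matrix.cons_val]
    have : z.re ^ 2 + z.im ^ 2 + 1 ≠ 0 := by positivity
    field_simp
    ring⟩

section Stereographic

variable (b : OrthonormalBasis (Fin 3) ℝ E3)

theorem repr_sq_sum (y : S2) :
    b.repr (y : E3) 0 ^ 2 + b.repr (y : E3) 1 ^ 2 + b.repr (y : E3) 2 ^ 2 = 1 := by
  have h : ‖b.repr (y : E3)‖ = 1 := by
    rw [LinearIsometryEquiv.norm_map]; exact mem_sphere_zero_iff_norm.1 y.2
  rw [EuclideanSpace.norm_eq, Real.sqrt_eq_one] at h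
  simpa [Fin.sum_univ_three] using h

theorem S2.ext_repr {y y' : S2} (h0 : b.repr (y : E3) 0 = b.repr (y' : E3) 0)
    (h1 : b.repr (y : E3) 1 = b.repr (y' : E3) 1) (h2 : b.repr (y : E3) 2 = b.repr (y' : E3) 2) :
    y = y' := by
  refine Subtype.ext (b.repr.injective ?_)
  ext i
  fin_cases i
  exacts [h0, h1, h2]

theorem continuous_repr (i : Fin 3) : Continuous fun y : S2 => b.repr (y : E3) i := by
  fun_prop

theorem continuous_frameCoord : Continuous (frameCoord b) := by
  have : frameCoord b = fun y : S2 => (b.repr (y : E3) 0 : ℂ) + b.repr (y : E3) 1 * Complex.I := by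
    ext y
    apply Complex.ext <;> simp [frameCoord]
  rw [this]
  fun_prop

theorem repr_stereoInv_zero (z : ℂ) :
    b.repr (stereoInv b z : E3) 0 = 2 * z.re / (z.re ^ 2 + z.im ^ 2 + 1) := by
  simp [stereoInv]

theorem repr_stereoInv_one (z : ℂ) :
    b.repr (stereoInv b z : E3) 1 = 2 * z.im / (z.re ^ 2 + z.im ^ 2 + 1) := by
  simp [stereoInv]

theorem repr_stereoInv_two (z : ℂ) :
    b.repr (stereoInv b z : E3) 2 = (z.re ^ 2 + z.im ^ 2 - 1) / (z.re ^ 2 + z.im ^ 2 + 1) := by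
  simp [stereoInv]

theorem stereoProj_re (y : S2) :
    (stereoProj b y).re = b.repr (y : E3) 0 / (1 - b.repr (y : E3) 2) := by
  rw [stereoProj, Complex.div_ofReal_re, frameCoord]

theorem stereoProj_im (y : S2) :
    (stereoProj b y).im = b.repr (y : E3) 1 / (1 - b.repr (y : E3) 2) := by
  rw [stereoProj, Complex.div_ofReal_im, frameCoord]

theorem stereoProj_stereoInv (z : ℂ) : stereoProj b (stereoInv b z) = z := by
  have : z.re ^ 2 + z.im ^ 2 + 1 ≠ 0 := by positivity
  have h2 : 1 - b.repr (stereoInv b z : E3) 2 = 2 / (z.re ^ 2 + z.im ^ 2 + 1) := by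
    rw [repr_stereoInv_two]; field_simp; ring
  apply Complex.ext
  · rw [stereoProj_re, h2, repr_stereoInv_zero]; field_simp
  · rw [stereoProj_im, h2, repr_stereoInv_one]; field_simp

variable {b} {x : S2}

theorem repr_last_eq_inner (hx : b 2 = (x : E3))
    (y : S2) : b.repr (y : E3) 2 = inner ℝ (x : E3) (y : E3) := by
  rw [b.repr_apply_apply, hx]

theorem norm_sub_sq_eq (hx : b 2 = (x : E3))
    (y : S2) : ‖(y : E3) - x‖ ^ 2 = 2 * (1 - b.repr (y : E3) 2) := by
  rw [norm_sub_sq_real, repr_last_eq_inner hx, real_inner_comm, mem_sphere_zero_iff_norm.1 y.2,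
    mem_sphere_zero_iff_norm.1 x.2]
  ring

theorem repr_last_eq_one_iff (hx : b 2 = (x : E3)) (y : S2) : b.repr (y : E3) 2 = 1 ↔ y = x := by
  have h := norm_sub_sq_eq hx y
  constructor
  · intro h1
    rw [h1, sub_self, mul_zero, sq_eq_zero_iff, norm_eq_zero, sub_eq_zero] at h
    exact Subtype.ext h
  · rintro rfl
    rw [sub_self, norm_zero] at h
    linarith

theorem repr_last_lt_one (hx : b 2 = (x : E3)) {y : S2} (hy : y ≠ x) : b.repr (y : E3) 2 < 1 := by
  have h := norm_sub_sq_eq hx y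
  have : 0 < ‖(y : E3) - x‖ := norm_pos_iff.2 (sub_ne_zero.2 fun h => hy (Subtype.ext h))
  nlinarith [sq_pos_of_pos this]

theorem stereoInv_ne (hx : b 2 = (x : E3)) (z : ℂ) : stereoInv b z ≠ x := by
  rw [Ne, ← repr_last_eq_one_iff hx, repr_stereoInv_two, div_eq_one_iff_eq (by positivity)]
  linarith

theorem stereoInv_stereoProj (hx : b 2 = (x : E3))
    {y : S2} (hy : y ≠ x) : stereoInv b (stereoProj b y) = y := by
  have h1 := repr_last_lt_one hx hy
  have h2 := repr_sq_sum b y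
  have h3 : 1 - b.repr (y : E3) 2 ≠ 0 := by linarith
  have hN : (stereoProj b y).re ^ 2 + (stereoProj b y).im ^ 2 + 1
      = 2 / (1 - b.repr (y : E3) 2) := by
    rw [stereoProj_re, stereoProj_im]
    field_simp
    linear_combination h2
  refine S2.ext_repr b ?_ ?_ ?_
  · rw [repr_stereoInv_zero, hN, stereoProj_re]; field_simp
  · rw [repr_stereoInv_one, hN, stereoProj_im]; field_simp
  · rw [repr_stereoInv_two, hN, show (stereoProj b y).re ^ 2 + (stereoProj b y).im ^ 2 - 1
      = 2 / (1 - b.repr (y : E3) 2) - 2 by linear_combination hN]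
    field_simp; ring

theorem continuousOn_stereoProj (hx : b 2 = (x : E3)) : ContinuousOn (stereoProj b) {x}ᶜ := by
  refine (continuous_frameCoord b).continuousOn.div ?_ fun y hy => ?_
  · exact (Complex.continuous_ofReal.comp
      (continuous_const.sub (continuous_repr b 2))).continuousOn
  · have := repr_last_lt_one hx hy
    exact Complex.ofReal_ne_zero.2 (by linarith)

theorem stereoProj_injOn (hx : b 2 = (x : E3)) : Set.InjOn (stereoProj b) {x}ᶜ :=
  fun y hy y' hy' h => by
  rw [← stereoInv_stereoProj hx hy, h, stereoInv_stereoProj hx hy']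

theorem tendsto_stereoProj_nhdsNE (hx : b 2 = (x : E3))
    : Tendsto (stereoProj b) (𝓝[≠] x) (Bornology.cobounded ℂ) := by
  rw [← tendsto_norm_atTop_iff_cobounded]
  have h1 : Tendsto (fun y : S2 => 1 - b.repr (y : E3) 2) (𝓝[≠] x) (𝓝[>] 0) := by
    refine tendsto_nhdsWithin_iff.2 ⟨?_, ?_⟩
    · have h := ((continuous_const (y := (1 : ℝ))).sub (continuous_repr b 2)).tendsto x
      rw [Pi.sub_apply, (repr_last_eq_one_iff hx x).2 rfl, sub_self] at h
      exact h.mono_left nhdsWithin_le_nhds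
    · filter_upwards [self_mem_nhdsWithin] with y hy
      exact sub_pos.2 (repr_last_lt_one hx hy)
  have h2 := Real.tendsto_sqrt_atTop.comp (tendsto_atTop_add_const_right _ (-1)
    ((tendsto_inv_nhdsGT_zero.comp h1).const_mul_atTop (two_pos)))
  refine h2.congr' ?_
  filter_upwards [self_mem_nhdsWithin] with y hy
  have h3 := repr_last_lt_one hx hy
  have h4 : 1 - b.repr (y : E3) 2 ≠ 0 := by linarith
  rw [Function.comp_apply, Complex.norm_def, Complex.normSq_apply, stereoProj_re, stereoProj_im]
  congr 1
  simp only [Function.comp_apply]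
  field_simp
  linear_combination -repr_sq_sum b y

theorem tendsto_stereoInv_cobounded (hx : b 2 = (x : E3))
    : Tendsto (stereoInv b) (Bornology.cobounded ℂ) (𝓝[≠] x) := by
  refine tendsto_nhdsWithin_iff.2 ⟨?_, .of_forall (stereoInv_ne hx)⟩
  rw [tendsto_subtype_rng, tendsto_iff_norm_sub_tendsto_zero]
  have h1 : Tendsto (fun z : ℂ => ‖z‖ ^ 2 + 1) (Bornology.cobounded ℂ) atTop :=
    tendsto_atTop_add_const_right _ _
      ((tendsto_pow_atTop two_ne_zero).comp tendsto_norm_cobounded_atTop)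
  have h2 := (Real.continuous_sqrt.tendsto _).comp (h1.inv_tendsto_atTop.const_mul 4)
  rw [mul_zero, Real.sqrt_zero] at h2
  refine h2.congr fun z => ?_
  rw [Function.comp_apply, ← Real.sqrt_sq (norm_nonneg ((stereoInv b z : E3) - x)),
    norm_sub_sq_eq hx, repr_stereoInv_two]
  congr 1
  have h3 : z.re ^ 2 + z.im ^ 2 + 1 ≠ 0 := by positivity
  rw [Pi.inv_apply, ← Complex.normSq_eq_norm_sq, Complex.normSq_apply, ← sq, ← sq]
  field_simp
  ring

end Stereographic

theorem continuous_stereoInv (b : OrthonormalBasis (Fin 3) ℝ E3) : Continuous (stereoInv b) := by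
  refine Continuous.subtype_mk (b.repr.symm.continuous.comp
    ((PiLp.continuous_toLp 2 _).comp (continuous_pi fun i => ?_))) _
  have h0 : ∀ z : ℂ, z.re ^ 2 + z.im ^ 2 + 1 ≠ 0 := fun z => by positivity
  have h1 := Complex.continuous_re
  have h2 := Complex.continuous_im
  fin_cases i
  · exact Continuous.div (by fun_prop) (by fun_prop) h0
  · exact Continuous.div (by fun_prop) (by fun_prop) h0
  · exact Continuous.div (by fun_prop) (by fun_prop) h0

theorem planeCircle_eq {R : ℝ} (hR : 0 < R) (t : ℝ) :
    planeCircle R t = ⟨R * Real.cos (2 * Real.pi * t), R * Real.sin (2 * Real.pi * t)⟩ := by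
  have : planeCircle R t = Complex.exp (Real.log R) *
      Complex.exp ((2 * Real.pi * t : ℝ) * Complex.I) := by
    rw [planeCircle, ← Complex.exp_add]; push_cast; ring_nf
  rw [this, ← Complex.ofReal_exp, Real.exp_log hR]
  apply Complex.ext
  · rw [Complex.re_ofReal_mul, Complex.exp_ofReal_mul_I_re]
  · rw [Complex.im_ofReal_mul, Complex.exp_ofReal_mul_I_im]

/-- A point at angular distance `r` from the pole of projection has modulus `cot (r / 2)`. -/
theorem frameCircle_two_mul_arctan_inv (b : OrthonormalBasis (Fin 3) ℝ E3) {R : ℝ} (hR : 0 < R)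
    (t : ℝ) : frameCircle b (2 * Real.arctan R⁻¹) t = stereoInv b (planeCircle R t) := by
  have hc := Real.cos_sq_arctan R⁻¹
  have hs : Real.sin (Real.arctan R⁻¹) = R⁻¹ * Real.cos (Real.arctan R⁻¹) := by
    rw [Real.sin_arctan, Real.cos_arctan]; ring
  have hsin : Real.sin (2 * Real.arctan R⁻¹) = 2 * R / (R ^ 2 + 1) := by
    rw [Real.sin_two_mul, hs, show 2 * (R⁻¹ * Real.cos (Real.arctan R⁻¹)) *
      Real.cos (Real.arctan R⁻¹) = 2 * R⁻¹ * Real.cos (Real.arctan R⁻¹) ^ 2 by ring, hc]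
    field_simp
  have hcos : Real.cos (2 * Real.arctan R⁻¹) = (R ^ 2 - 1) / (R ^ 2 + 1) := by
    rw [Real.cos_two_mul, hc]
    field_simp
    ring
  have hN : (R * Real.cos (2 * Real.pi * t)) ^ 2 + (R * Real.sin (2 * Real.pi * t)) ^ 2
      = R ^ 2 := by
    linear_combination R ^ 2 * Real.sin_sq_add_cos_sq (2 * Real.pi * t)
  refine S2.ext_repr b ?_ ?_ ?_
  · rw [repr_stereoInv_zero, planeCircle_eq hR, hN]
    simp [frameCircle, hsin]; ring
  · rw [repr_stereoInv_one, planeCircle_eq hR, hN]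
    simp [frameCircle, hsin]; ring
  · rw [repr_stereoInv_two, planeCircle_eq hR, hN]
    simp [frameCircle, hcos]

/-! ### Orientation on large circles, and oriented frames. -/

theorem IsOrientationPreserving.eventually_atTop {f : S2 ≃ₜ S2} (hf : IsOrientationPreserving f)
    {x : S2} {b b' : OrthonormalBasis (Fin 3) ℝ E3} (hb : IsOrientedFrameAt b x)
    (hb' : IsOrientedFrameAt b' (f x)) : ∀ᶠ R : ℝ in atTop,
      HasWindingNumber (fun t => frameCoord b' (f (stereoInv b (planeCircle R t)))) 1 := by
  have h : Tendsto (fun R : ℝ => 2 * Real.arctan R⁻¹) atTop (𝓝[>] 0) := by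
    refine tendsto_nhdsWithin_iff.2 ⟨?_, ?_⟩
    · have := ((Real.continuous_arctan.tendsto 0).comp tendsto_inv_atTop_zero).const_mul 2
      simpa using this
    · filter_upwards [eventually_gt_atTop 0] with R hR
      exact mul_pos two_pos (Real.arctan_pos.2 (inv_pos.2 hR))
  filter_upwards [h.eventually (hf x b b' hb hb'), eventually_gt_atTop 0] with R h1 hR
  exact h1.congr fun t _ => by rw [frameCircle_two_mul_arctan_inv b hR]

theorem eventually_planeCircle {P : ℂ → Prop} (h : ∀ᶠ z in Bornology.cobounded ℂ, P z) :
    ∀ᶠ R : ℝ in atTop, ∀ t, P (planeCircle R t) := by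
  rw [← comap_norm_atTop, eventually_comap] at h
  filter_upwards [h, eventually_gt_atTop 0] with R h hR t
  exact h _ (norm_planeCircle hR t)

theorem exists_unit_orthogonal (u v : E3) :
    ∃ e : E3, ‖e‖ = 1 ∧ inner ℝ e u = 0 ∧ inner ℝ e v = 0 := by
  set W := Submodule.span ℝ ({u, v} : Set E3) with hW
  have h1 : Module.finrank ℝ W ≤ 2 := by
    classical
    have := finrank_span_finset_le_card (R := ℝ) ({u, v} : Finset E3)
    rw [Set.finrank, Finset.coe_pair] at this
    exact this.trans Finset.card_le_two
  have h2 := W.finrank_add_finrank_orthogonal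
  rw [finrank_euclideanSpace_fin] at h2
  obtain ⟨w, hw, hw0⟩ := Submodule.exists_mem_ne_zero_of_ne_bot (p := Wᗮ) (by
    intro h
    rw [h, finrank_bot] at h2
    omega)
  have h3 : ∀ x ∈ ({u, v} : Set E3), inner ℝ w x = 0 := fun x hx =>
    (Submodule.mem_orthogonal' W w).1 hw x (Submodule.subset_span hx)
  refine ⟨‖w‖⁻¹ • w, norm_smul_inv_norm hw0, ?_, ?_⟩
  · rw [real_inner_smul_left, h3 u (by simp), mul_zero]
  · rw [real_inner_smul_left, h3 v (by simp), mul_zero]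

theorem Orthonormal.exists_orthonormalBasis_coe_eq {v : Fin 3 → E3} (hv : Orthonormal ℝ v) :
    ∃ b : OrthonormalBasis (Fin 3) ℝ E3, ⇑b = v := by
  have hc : Fintype.card (Fin 3) = Module.finrank ℝ E3 := by simp
  refine ⟨(basisOfOrthonormalOfCardEqFinrank hv hc).toOrthonormalBasis (by simpa using hv), ?_⟩
  simp

theorem orthonormal_triple {u v w : E3} (hu : ‖u‖ = 1) (hv : ‖v‖ = 1) (hw : ‖w‖ = 1)
    (huv : inner ℝ u v = 0) (huw : inner ℝ u w = 0) (hvw : inner ℝ v w = 0) :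
    Orthonormal ℝ ![u, v, w] := by
  rw [orthonormal_vecCons_iff, orthonormal_vecCons_iff, orthonormal_vecCons_iff]
  refine ⟨hu, ?_, hv, ?_, hw, by simp, by simp [Orthonormal, Pairwise]⟩
  · simp [Fin.forall_fin_two, huv, huw]
  · simp [hvw]

/-- Changing the sign of the first vector corrects the orientation and leaves the two prescribed
vectors alone. -/
theorem exists_isOrientedFrameAt (x : S2) {e : E3} (he : ‖e‖ = 1) (hex : inner ℝ e (x : E3) = 0) :
    ∃ b : OrthonormalBasis (Fin 3) ℝ E3, IsOrientedFrameAt b x ∧ b 1 = e := by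
  obtain ⟨u, hu, hue, hux⟩ := exists_unit_orthogonal e x
  have hx : ‖(x : E3)‖ = 1 := mem_sphere_zero_iff_norm.1 x.2
  obtain ⟨b, hb⟩ := (orthonormal_triple hu he hx hue hux hex).exists_orthonormalBasis_coe_eq
  obtain ⟨b', hb'⟩ := (orthonormal_triple (u := -u) (by rwa [norm_neg]) he hx
    (by rw [inner_neg_left, hue, neg_zero]) (by rw [inner_neg_left, hux, neg_zero])
    hex).exists_orthonormalBasis_coe_eq
  set std := (EuclideanSpace.basisFun (Fin 3) ℝ).toBasis
  have hneg : std.det b'.toBasis = -std.det b.toBasis := by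
    have h : (b' : Fin 3 → E3) = Function.update b 0 (-b 0) := by
      rw [hb, hb']
      ext i : 1
      fin_cases i <;> simp
    rw [b'.coe_toBasis, b.coe_toBasis, h, AlternatingMap.map_update_neg, Function.update_eq_self]
  by_cases h : 0 < std.det b.toBasis
  · exact ⟨b, ⟨by simp [hb], ((std.orientation_eq_iff_det_pos _).2 h).symm⟩, by simp [hb]⟩
  · have h0 := (std.isUnit_det b.toBasis).ne_zero
    refine ⟨b', ⟨by simp [hb'], ((std.orientation_eq_iff_det_pos _).2 ?_).symm⟩, by simp [hb']⟩
    rw [hneg]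
    exact neg_pos.2 (lt_of_le_of_ne (not_lt.1 h) h0)

/-- Oriented frames at two points which differ by a rotation in the plane of the two points
and by a half turn about the second one. -/
theorem exists_isOrientedFrameAt_pair (p q : S2) :
    ∃ b b' : OrthonormalBasis (Fin 3) ℝ E3, IsOrientedFrameAt b p ∧ IsOrientedFrameAt b' q ∧
      b.repr (q : E3) 1 = 0 ∧ ∀ y : S2, frameCoord b' y =
        ⟨b.repr (q : E3) 0 * b.repr (y : E3) 2 - b.repr (q : E3) 2 * b.repr (y : E3) 0,
          -b.repr (y : E3) 1⟩ := by
  obtain ⟨e, he, hep, heq⟩ := exists_unit_orthogonal p q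
  obtain ⟨b, hb, hb1⟩ := exists_isOrientedFrameAt p he hep
  have hq1 : b.repr (q : E3) 1 = 0 := by rw [b.repr_apply_apply, hb1, heq]
  have hsq := repr_sq_sum b q
  rw [hq1] at hsq
  set s := b.repr (q : E3) 0
  set c := b.repr (q : E3) 2
  have hq : (q : E3) = s • b 0 + c • b 2 := by
    rw [← b.sum_repr (q : E3), Fin.sum_univ_three, hq1, zero_smul, add_zero]
  have hin : ∀ i j, inner ℝ (b i) (b j) = if i = j then (1 : ℝ) else 0 :=
    orthonormal_iff_ite.1 b.orthonormal
  have hnorm : ∀ w : E3, inner ℝ w w = 1 → ‖w‖ = 1 := fun w hw => by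
    rw [real_inner_self_eq_norm_sq] at hw
    exact (pow_eq_one_iff_of_nonneg (norm_nonneg w) two_ne_zero).1 hw
  obtain ⟨b', hb'⟩ := (orthonormal_triple (u := s • b 2 - c • b 0) (v := -b 1)
    (w := s • b 0 + c • b 2)
    (hnorm _ (by
      simp only [inner_sub_left, inner_sub_right, real_inner_smul_left, real_inner_smul_right, hin]
      simp
      linear_combination hsq))
    (by simp)
    (hnorm _ (by
      simp only [inner_add_left, inner_add_right, real_inner_smul_left, real_inner_smul_right, hin]
      simp
      linear_combination hsq))
    (by simp [inner_sub_left, real_inner_smul_left, hin])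
    (by
      simp [inner_sub_left, inner_add_right, real_inner_smul_left, real_inner_smul_right, hin]
      ring)
    (by simp [inner_add_right, real_inner_smul_right, hin])).exists_orthonormalBasis_coe_eq
  refine ⟨b, b', hb, ⟨by simp [hb', hq], ?_⟩, hq1, fun y => ?_⟩
  · rw [← hb.2, eq_comm, Module.Basis.orientation_eq_iff_det_pos]
    have : b.toBasis.det b'.toBasis = 1 := by
      rw [Module.Basis.det_apply, Matrix.det_fin_three]
      simp [Module.Basis.toMatrix_apply, hb']
      linear_combination hsq
    rw [this]
    exact one_pos
  · simp [frameCoord, s, c, b.repr_apply_apply, b'.repr_apply_apply, hb', inner_sub_left,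
      real_inner_smul_left]

/-! ### Fixed points on the sphere. -/

/-- Away from a fixed point, an orientation-preserving homeomorphism which interchanges two points
has another fixed point. -/
theorem IsOrientationPreserving.exists_isFixedPt_ne {f : S2 ≃ₜ S2}
    (hf : IsOrientationPreserving f) {x p q : S2} (hx : f x = x) (hpq : p ≠ q) (hp : f p = q)
    (hq : f q = p) : ∃ y, y ≠ x ∧ f y = y := by
  have hpx : p ≠ x := by rintro rfl; exact hpq (hx.symm.trans hp)
  have hqx : q ≠ x := by rintro rfl; exact hpq (hq.symm.trans hx)
  obtain ⟨e, he, hex, -⟩ := exists_unit_orthogonal x x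
  obtain ⟨b, hb, -⟩ := exists_isOrientedFrameAt x he hex
  have hne : ∀ z, f (stereoInv b z) ≠ x := fun z h =>
    stereoInv_ne hb.1 z (f.injective (h.trans hx.symm))
  set h : ℂ → ℂ := fun z => stereoProj b (f (stereoInv b z))
  have hcont : Continuous h := (continuousOn_stereoProj hb.1).comp_continuous
    (f.continuous.comp (continuous_stereoInv b)) hne
  have hinj : Function.Injective h := fun z z' hz => by
    have := f.injective (stereoProj_injOn hb.1 (hne z) (hne z') hz)
    rw [← stereoProj_stereoInv b z, this, stereoProj_stereoInv]
  have hproj : ∀ y, y ≠ x → h (stereoProj b y) = stereoProj b (f y) := fun y hy => by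
    simp only [h, stereoInv_stereoProj hb.1 hy]
  have hlim : Tendsto h (Bornology.cobounded ℂ) (Bornology.cobounded ℂ) := by
    have h1 : Tendsto (fun z => f (stereoInv b z)) (Bornology.cobounded ℂ) (𝓝[≠] x) := by
      refine tendsto_nhdsWithin_iff.2 ⟨?_, .of_forall hne⟩
      have := (f.continuous.tendsto x).comp
        ((tendsto_stereoInv_cobounded hb.1).mono_right nhdsWithin_le_nhds)
      rwa [hx] at this
    exact (tendsto_stereoProj_nhdsNE hb.1).comp h1
  have hbig := eventually_planeCircle
    ((tendsto_norm_cobounded_atTop.comp hlim).eventually_gt_atTop ‖h 0‖)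
  obtain ⟨R, hw, hR⟩ := ((hf.eventually_atTop hb (hx.symm ▸ hb)).and hbig).exists
  have hlt : ∀ t, 0 < 1 - b.repr (f (stereoInv b (planeCircle R t)) : E3) 2 := fun t =>
    sub_pos.2 (repr_last_lt_one hb.1 (hne _))
  have hcirc : Continuous fun t => f (stereoInv b (planeCircle R t)) :=
    f.continuous.comp ((continuous_stereoInv b).comp (continuous_planeCircle R))
  have hw1 : HasWindingNumber (fun t => h (planeCircle R t)) 1 := by
    -- Source and target use the same frame, and `stereoProj b` is `frameCoord b` times a positive
    -- real.
    refine (hw.mul_slitPlane (e := fun t =>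
      (((1 - b.repr (f (stereoInv b (planeCircle R t)) : E3) 2)⁻¹ : ℝ) : ℂ)) ?_ ?_ ?_).congr ?_
    · exact (Complex.continuous_ofReal.comp ((continuous_const.sub
        ((continuous_repr b 2).comp hcirc)).inv₀ fun t => (hlt t).ne')).continuousOn
    · exact fun t _ => Complex.ofReal_mem_slitPlane.2 (inv_pos.2 (hlt t))
    · simp only [planeCircle_zero_eq_one]
    · intro t _
      rw [Complex.ofReal_inv]
      rfl
  obtain ⟨z, hz⟩ := exists_fixedPoint_of_interchange hcont hinj
    (hw1.of_norm_lt (d := fun _ => h 0) continuousOn_const rfl fun t _ => hR t)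
    (fun h => hpq (stereoProj_injOn hb.1 hpx hqx h))
    ((hproj p hpx).trans (by rw [hp])) ((hproj q hqx).trans (by rw [hq]))
  refine ⟨stereoInv b z, stereoInv_ne hb.1 z, ?_⟩
  rw [← stereoInv_stereoProj hb.1 (hne z)]
  exact congrArg (stereoInv b) hz

/-- Comparison of the chart of the second frame with stereographic projection for the first. -/
theorem conj_frameCoord_eq {b b' : OrthonormalBasis (Fin 3) ℝ E3} {p q y : S2}
    (hb : b 2 = (p : E3)) (hq1 : b.repr (q : E3) 1 = 0)
    (hcoord : frameCoord b' y =
        ⟨b.repr (q : E3) 0 * b.repr (y : E3) 2 - b.repr (q : E3) 2 * b.repr (y : E3) 0,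
          -b.repr (y : E3) 1⟩) (hq : q ≠ p) (hy : y ≠ p) :
    (starRingEnd ℂ) (frameCoord b' y) = (stereoProj b y - ((stereoProj b q).re : ℂ)) *
      ((starRingEnd ℂ) (1 + ((stereoProj b q).re : ℂ) * stereoProj b y) *
        (((1 - b.repr (q : E3) 2) * (1 - b.repr (y : E3) 2) / 2 : ℝ) : ℂ)) := by
  -- Where `1 + αz ≠ 0`, the right side is a positive multiple of `(z - α) / (1 + αz)`, the rotation
  -- of the sphere that takes `q` to the origin. The conjugate on the left appears because
  -- projection from `p` reverses the orientation given by the outward normal.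
  have hc : 1 - b.repr (q : E3) 2 ≠ 0 := (sub_pos.2 (repr_last_lt_one hb hq)).ne'
  have hw : 1 - b.repr (y : E3) 2 ≠ 0 := (sub_pos.2 (repr_last_lt_one hb hy)).ne'
  have hqs := repr_sq_sum b q
  have hys := repr_sq_sum b y
  rw [hq1] at hqs
  rw [hcoord]
  set s := b.repr (q : E3) 0
  set c := b.repr (q : E3) 2
  set w := b.repr (y : E3) 2
  set α := (stereoProj b q).re with hα
  set z := stereoProj b y
  have h1 : α * (1 - c) = s := by rw [hα, stereoProj_re, div_mul_cancel₀ _ hc]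
  have h2 : α ^ 2 * (1 - c) = 1 + c := by
    refine mul_right_cancel₀ hc ?_
    linear_combination (α * (1 - c) + s) * h1 + hqs
  have h3 : z.re * (1 - w) = b.repr (y : E3) 0 := by rw [stereoProj_re, div_mul_cancel₀ _ hw]
  have h4 : z.im * (1 - w) = b.repr (y : E3) 1 := by rw [stereoProj_im, div_mul_cancel₀ _ hw]
  have h5 : (z.re ^ 2 + z.im ^ 2) * (1 - w) = 1 + w := by
    refine mul_right_cancel₀ hw ?_
    linear_combination (z.re * (1 - w) + b.repr (y : E3) 0) * h3 +
      (z.im * (1 - w) + b.repr (y : E3) 1) * h4 + hys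
  rw [← h3, ← h4, ← h1]
  apply Complex.ext
  · simp
    linear_combination (-(α * (1 - c)) / 2) * h5 + (z.re * (1 - w) / 2) * h2
  · simp
    linear_combination (-(z.im * (1 - w)) / 2) * h2

/-- An orientation-preserving homeomorphism of the sphere which interchanges two points has a
fixed point. -/
theorem IsOrientationPreserving.exists_isFixedPt {f : S2 ≃ₜ S2}
    (hf : IsOrientationPreserving f) {p q : S2} (hpq : p ≠ q) (hp : f p = q)
    (hq : f q = p) : ∃ y, f y = y := by
  obtain ⟨b, b', hb, hb', hq1, hcoord⟩ := exists_isOrientedFrameAt_pair p q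
  set α : ℝ := (stereoProj b q).re with hα
  set a : ℂ := (α : ℂ) with ha
  have haq : stereoProj b q = a := by
    apply Complex.ext
    · simp [ha, hα]
    · rw [stereoProj_im, hq1, ha, Complex.ofReal_im, zero_div]
  have hqa : stereoInv b a = q := by rw [← haq, stereoInv_stereoProj hb.1 hpq.symm]
  have hne : ∀ z, z ≠ a → f (stereoInv b z) ≠ p := fun z hz h => by
    have := f.injective (h.trans hq.symm)
    rw [← hqa] at this
    exact hz (by rw [← stereoProj_stereoInv b z, this, stereoProj_stereoInv])
  set h : ℂ → ℂ := fun z => stereoProj b (f (stereoInv b z))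
  have hcont : ContinuousOn h {a}ᶜ := (continuousOn_stereoProj hb.1).comp
    (f.continuous.comp (continuous_stereoInv b)).continuousOn hne
  have hna : ∀ z, z ≠ a → h z ≠ a := fun z hz hza => by
    rw [← haq] at hza
    have := stereoProj_injOn hb.1 (hne z hz) hpq.symm hza
    exact stereoInv_ne hb.1 z (f.injective (this.trans hp.symm))
  have hinf : Tendsto h (Bornology.cobounded ℂ) (𝓝 a) := by
    have h1 := (f.continuous.tendsto p).comp
      ((tendsto_stereoInv_cobounded hb.1).mono_right nhdsWithin_le_nhds)
    rw [hp] at h1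
    rw [← haq]
    exact (((continuousOn_stereoProj hb.1).continuousAt
      (isOpen_compl_singleton.mem_nhds hpq.symm)).tendsto).comp h1
  have hlim : Tendsto h (𝓝[≠] a) (Bornology.cobounded ℂ) := by
    have h1 : Tendsto (fun z => f (stereoInv b z)) (𝓝[≠] a) (𝓝[≠] p) := by
      refine tendsto_nhdsWithin_iff.2 ⟨?_, ?_⟩
      · have := (f.continuous.comp (continuous_stereoInv b)).tendsto a
        rw [Function.comp_apply, hqa, hq] at this
        exact this.mono_left nhdsWithin_le_nhds
      · filter_upwards [self_mem_nhdsWithin] with z hz using hne z hz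
    exact (tendsto_stereoProj_nhdsNE hb.1).comp h1
  have hpos : ∀ᶠ z in Bornology.cobounded ℂ, 0 < (1 + α * h z).re := by
    have h1 : Tendsto (fun z => (1 + α * h z).re) (Bornology.cobounded ℂ)
        (𝓝 (1 + (α : ℂ) * a).re) :=
      (Complex.continuous_re.tendsto _).comp ((hinf.const_mul _).const_add _)
    -- The limit is `1 + α ^ 2`, as `a = α` is real.
    refine h1.eventually_const_lt ?_
    rw [ha, ← Complex.ofReal_mul, Complex.add_re, Complex.one_re, Complex.ofReal_re]
    nlinarith [sq_nonneg α]
  obtain ⟨R, hw, hR, haR⟩ := ((hf.eventually_atTop hb (hp.symm ▸ hb')).and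
    ((eventually_planeCircle hpos).and (eventually_gt_atTop ‖a‖))).exists
  have hRa : ∀ t, planeCircle R t ≠ a := fun t h => by
    have := norm_planeCircle ((norm_nonneg a).trans_lt haR) t
    rw [h] at this
    exact haR.ne this
  have hcirc : Continuous fun t => h (planeCircle R t) :=
    hcont.comp_continuous (continuous_planeCircle R) hRa
  -- Conjugating the chart at `q` turns winding number `1` into `-1`; the remaining factor `E` stays
  -- in the right half-plane and contributes nothing.
  have hd : HasWindingNumber (fun t => h (planeCircle R t) - a) (-1) := by
    have hcirc' : Continuous fun t => f (stereoInv b (planeCircle R t)) :=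
      f.continuous.comp ((continuous_stereoInv b).comp (continuous_planeCircle R))
    set E : ℝ → ℂ := fun t => (starRingEnd ℂ) (1 + (α : ℂ) * h (planeCircle R t)) *
      (((1 - b.repr (q : E3) 2) *
        (1 - b.repr (f (stereoInv b (planeCircle R t)) : E3) 2) / 2 : ℝ) : ℂ) with hE
    have hEpos : ∀ t, 0 < (E t).re := fun t => by
      simp only [hE]
      rw [Complex.re_mul_ofReal, Complex.conj_re]
      exact mul_pos (hR t) (half_pos (mul_pos (sub_pos.2 (repr_last_lt_one hb.1 hpq.symm))
        (sub_pos.2 (repr_last_lt_one hb.1 (hne _ (hRa t))))))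
    have hE0 : ∀ t, E t ≠ 0 := fun t h0 => by
      have := hEpos t
      rw [h0, Complex.zero_re] at this
      exact lt_irrefl _ this
    have hEc : Continuous E := by
      have := (continuous_repr b 2).comp hcirc'
      exact (Complex.continuous_conj.comp (continuous_const.add (continuous_const.mul hcirc))).mul
        (Complex.continuous_ofReal.comp
          ((continuous_const.mul (continuous_const.sub this)).div_const 2))
    refine (hw.conj.mul_slitPlane (hEc.inv₀ hE0).continuousOn (fun t _ => ?_) ?_).congr ?_
    · refine Or.inl ?_
      rw [Pi.inv_apply, Complex.inv_re]
      exact div_pos (hEpos t) (Complex.normSq_pos.2 (hE0 t))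
    · simp only [hE, Pi.inv_apply, planeCircle_zero_eq_one]
    · intro t _
      rw [conj_frameCoord_eq hb.1 hq1 (hcoord _) hpq.symm (hne _ (hRa t))]
      exact (mul_inv_cancel_right₀ (hE0 t) _).symm
  obtain ⟨z, hz, hhz⟩ := exists_fixedPoint_of_interchange_ends hcont hna hinf hlim haR hd
  refine ⟨stereoInv b z, ?_⟩
  rw [← stereoInv_stereoProj hb.1 (hne z hz)]
  exact congrArg (stereoInv b) hhz

theorem mainTheorem1 (f : S2 ≃ₜ S2) (hf : IsOrientationPreserving f)
    (hper : ∃ p : S2, Function.minimalPeriod f p = 2) :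
    ∃ x y : S2, x ≠ y ∧ Function.IsFixedPt f x ∧ Function.IsFixedPt f y := by
  obtain ⟨p, hp⟩ := hper
  have hne : p ≠ f p := fun h => by
    have := Function.minimalPeriod_eq_one_iff_isFixedPt.2 (show Function.IsFixedPt f p from h.symm)
    omega
  have hq : f (f p) = p := by
    have := Function.iterate_minimalPeriod (f := f) (x := p)
    rwa [hp] at this
  obtain ⟨x, hx⟩ := hf.exists_isFixedPt hne rfl hq
  obtain ⟨y, hyx, hy⟩ := hf.exists_isFixedPt_ne hx hne rfl hq
  exact ⟨x, y, hyx.symm, hx, hy⟩
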